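/- Let $M,N\ge 0$ be integers and $\alpha\in\mathbb C$ (with the convention $0^0=1$). Let $|0\rangle=\binom10$ (empty) and $|1\rangle=\binom01$ (occupied) be the standard basis of $\mathbb C^2$, and put $\sigma^+=|0\rangle\langle1|$, $\sigma^-=|1\rangle\langle0|$, $s=|0\rangle\langle0|$, $n=|1\rangle\langle1|$. For $u\in\mathbb C\setminus\{0\}$ let $$L_{\mu j}(u)=u\,s_\mu s_j+\sigma^-_\mu\sigma^+_j+\sigma^+_\mu\sigma^-_j+(\alpha u-u^{-1})\,n_\mu s_j+\alpha u\,n_\mu n_j ,$$ acting on an auxiliary space $W_\mu=\mathbb C^2$ and on the $j$-th factor $V_j=\mathbb C^2$ of the quantum space $V_1\otimes\cdots\otimes V_M$. Let $T_\mu(u)=L_{\mu M}(u)\cdots L_{\mu 2}(u)L_{\mu 1}(u)$ be the monodromy matrix, and let $B(u)={}_\mu\langle0|T_\mu(u)|1\rangle_\mu$ and $C(u)={}_\mu\langle1|T_\mu(u)|0\rangle_\mu$ be its upper right and lower left entries, which are operators on $V_1\otimes\cdots\otimes V_M$. Let $|\Omega\rangle=|0\rangle^{\otimes M}$, $\langle\Omega|=\langle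 0|^{\otimes M}$, and $$|\psi(\{v\})\rangle=B(v_1)\cdots B(v_N)|\Omega\rangle,\qquad \langle\psi(\{u\})|=\langle\Omega|C(u_1)\cdots C(u_N),$$ $$|x_1\cdots x_N\rangle=\prod_{j=1}^N\sigma^-_{x_j}|\Omega\rangle,\qquad \langle x_1\cdots x_N|=\langle\Omega|\prod_{j=1}^N\sigma^+_{x_j}\qquad(1\le x_1<\cdots<x_N\le M).$$ Let $v_1,\dots,v_N$ be nonzero complex numbers with pairwise distinct squares. Then $$\sum_{1\le x_1<\cdots<x_N\le M}\alpha^{MN-\sum_{j=1}^N x_j}\,\langle x_1\cdots x_N|\psi(\{v\})\rangle=\prod_{j=1}^N v_j^{M+1}\prod_{1\le j<k\le N}\frac1{v_k^2-v_j^2}\ \det V,$$ where $V$ is the $N\times N$ matrix with entries, for $1\le k\le N$, $$V_{jk}=\sum_{m=0}^{j-1}(-1)^m\alpha^{M-m}\binom Mm v_k^{-2(m-j+1)}\quad(1\le j\le N-1),$$ $$V_{Nk}=-\sum_{m=\max(N-1,1)}^{M}(-1)^m\alpha^{M-m}\binom Mm v_k^{-2(m-N+1)} .$$ Let $u_1,\dots,u_N$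 be nonzero complex numbers with pairwise distinct squares. Then $$\sum_{1\le x_1<\cdots<x_N\le M}\alpha^{\sum_{j=1}^N x_j-N}\,\langle\psi(\{u\})|x_1\cdots x_N\rangle=\prod_{j=1}^N u_j^{M+1}\prod_{1\le j<k\le N}\frac1{u_j^2-u_k^2}\ \det\widetilde V,$$ where $\widetilde V$ is the $N\times N$ matrix with entries, for $1\le k\le N$, $$\widetilde V_{jk}=\sum_{m=0}^{N-j}(-1)^m\alpha^{M-m}\binom Mm u_k^{-2(m+j-N)}\quad(2\le j\le N),$$ $$\widetilde V_{1k}=-\sum_{m=\max(N-1,1)}^{M}(-1)^m\alpha^{M-m}\binom Mm u_k^{-2(m-N+1)} .$$ Terms with $m>M$ are zero, since $\binom Mm=0$, and sums over an empty range are zero. -/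

import Mathlib

open Finset Matrix
open scoped Kronecker

noncomputable section

namespace FiveVertex

/-! The one-parameter five-vertex model on `M` sites. A one-site (or auxiliary) space is `ℂ²`, whose
basis vector `0` is the empty state and `1` the occupied state. A vector of `(ℂ²)^{⊗ M}` is a function
on the occupation patterns `Fin M → Fin 2`, and an operator is a matrix indexed by such patterns
(row = output, column = input). -/

/-- `σ⁺ = |0⟩⟨1|`. -/
def sigmaPlus : Matrix (Fin 2) (Fin 2) ℂ := !![0, 1; 0, 0]

/-- `σ⁻ = |1⟩⟨0|`. -/
def sigmaMinus : Matrix (Fin 2) (Fin 2) ℂ := !![0, 0; 1, 0]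

/-- The projection `s = (1 + σᶻ)/2` onto the empty state. -/
def projEmpty : Matrix (Fin 2) (Fin 2) ℂ := !![1, 0; 0, 0]

/-- The projection `n = (1 - σᶻ)/2` onto the occupied state. -/
def projOcc : Matrix (Fin 2) (Fin 2) ℂ := !![0, 0; 0, 1]

/-- The `L`-operator on `W ⊗ V = ℂ² ⊗ ℂ²` (first factor auxiliary, second factor quantum). -/
def lOperator (α u : ℂ) : Matrix (Fin 2 × Fin 2) (Fin 2 × Fin 2) ℂ :=
  u • (projEmpty ⊗ₖ projEmpty) + sigmaMinus ⊗ₖ sigmaPlus + sigmaPlus ⊗ₖ sigmaMinus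
    + (α * u - u⁻¹) • (projOcc ⊗ₖ projEmpty) + (α * u) • (projOcc ⊗ₖ projOcc)

/-- The `L`-operator acting on the auxiliary space and on the `j`-th site, as an operator on
`W ⊗ V^{⊗ M}`. -/
def lAt {M : ℕ} (α u : ℂ) (j : Fin M) :
    Matrix (Fin 2 × (Fin M → Fin 2)) (Fin 2 × (Fin M → Fin 2)) ℂ :=
  Matrix.of fun p q =>
    if ∀ i, i ≠ j → p.2 i = q.2 i then lOperator α u (p.1, p.2 j) (q.1, q.2 j) else 0

/-- The (homogeneous) monodromy matrix `L_M(u) ⋯ L_2(u) L_1(u)`: the auxiliary line passes through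
site `1` first and through site `M` last. -/
def monodromy (M : ℕ) (α u : ℂ) :
    Matrix (Fin 2 × (Fin M → Fin 2)) (Fin 2 × (Fin M → Fin 2)) ℂ :=
  (List.ofFn fun j : Fin M => lAt α u j).reverse.prod

/-- The upper right block `B(u) = ⟨0|T(u)|1⟩` of the monodromy matrix. -/
def opB (M : ℕ) (α u : ℂ) : Matrix (Fin M → Fin 2) (Fin M → Fin 2) ℂ :=
  (monodromy M α u).submatrix (fun τ => (0, τ)) (fun σ => (1, σ))

/-- The lower left block `C(u) = ⟨1|T(u)|0⟩` of the monodromy matrix. -/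
def opC (M : ℕ) (α u : ℂ) : Matrix (Fin M → Fin 2) (Fin M → Fin 2) ℂ :=
  (monodromy M α u).submatrix (fun τ => (1, τ)) (fun σ => (0, σ))

/-- The vacuum `|0 ⋯ 0⟩` (also used as the dual vacuum `⟨0 ⋯ 0|`). -/
def vacuum (M : ℕ) : (Fin M → Fin 2) → ℂ := Pi.single (fun _ => 0) 1

/-- The off-shell state `|ψ(v)⟩ = B(v_1) ⋯ B(v_N) |Ω⟩`. -/
def stateKet (M : ℕ) {N : ℕ} (α : ℂ) (v : Fin N → ℂ) : (Fin M → Fin 2) → ℂ :=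
  (List.ofFn fun j : Fin N => opB M α (v j)).prod *ᵥ vacuum M

/-- The dual off-shell state `⟨ψ(u)| = ⟨Ω| C(u_1) ⋯ C(u_N)`. -/
def stateBra (M : ℕ) {N : ℕ} (α : ℂ) (u : Fin N → ℂ) : (Fin M → Fin 2) → ℂ :=
  vacuum M ᵥ* (List.ofFn fun j : Fin N => opC M α (u j)).prod

/-- A one-site operator acting on the `j`-th site of `V^{⊗ M}`. -/
def atSite {M : ℕ} (A : Matrix (Fin 2) (Fin 2) ℂ) (j : Fin M) :
    Matrix (Fin M → Fin 2) (Fin M → Fin 2) ℂ :=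
  Matrix.of fun τ σ => if ∀ i, i ≠ j → τ i = σ i then A (τ j) (σ j) else 0

/-- `|x_1 ⋯ x_N⟩ = ∏_j σ⁻_{x_j} |Ω⟩`. -/
def configKet {M N : ℕ} (x : Fin N → Fin M) : (Fin M → Fin 2) → ℂ :=
  (List.ofFn fun j : Fin N => atSite sigmaMinus (x j)).prod *ᵥ vacuum M

/-- `⟨x_1 ⋯ x_N| = ⟨Ω| ∏_j σ⁺_{x_j}`. -/
def configBra {M N : ℕ} (x : Fin N → Fin M) : (Fin M → Fin 2) → ℂ :=
  vacuum M ᵥ* (List.ofFn fun j : Fin N => atSite sigmaPlus (x j)).prod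

/-- The wavefunction `⟨x_1 ⋯ x_N | ψ(v)⟩`. -/
def wave {M N : ℕ} (α : ℂ) (x : Fin N → Fin M) (v : Fin N → ℂ) : ℂ :=
  configBra x ⬝ᵥ stateKet M α v

/-- The dual wavefunction `⟨ψ(u) | x_1 ⋯ x_N⟩`. -/
def dualWave {M N : ℕ} (α : ℂ) (u : Fin N → ℂ) (x : Fin N → Fin M) : ℂ :=
  stateBra M α u ⬝ᵥ configKet x

open Classical in
/-- The particle configurations `x_1 < ⋯ < x_N` on `M` sites. -/
def configurations (M N : ℕ) : Finset (Fin N → Fin M) :=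
  Finset.univ.filter fun x => StrictMono x

/-- The sum `x_1 + ⋯ + x_N` of the particle positions, sites being numbered from `1` to `M`. -/
def posSum {M N : ℕ} (x : Fin N → Fin M) : ℕ := ∑ j, ((x j : ℕ) + 1)

/-- The matrix `V`; the row index of the mathematical formula is `j + 1`. -/
def matV (M : ℕ) {N : ℕ} (α : ℂ) (v : Fin N → ℂ) : Matrix (Fin N) (Fin N) ℂ :=
  Matrix.of fun j k =>
    if (j : ℕ) + 1 < N then
      ∑ m ∈ Finset.range ((j : ℕ) + 1),
        (-1) ^ m * α ^ (M - m) * (M.choose m : ℂ) * v k ^ (-2 * ((m : ℤ) - ((j : ℤ) + 1) + 1))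
    else
      -∑ m ∈ Finset.Icc (max (N - 1) 1) M,
        (-1) ^ m * α ^ (M - m) * (M.choose m : ℂ) * v k ^ (-2 * ((m : ℤ) - (N : ℤ) + 1))

/-- The matrix `Ṽ`; the row index of the mathematical formula is `j + 1`. -/
def matVtilde (M : ℕ) {N : ℕ} (α : ℂ) (u : Fin N → ℂ) : Matrix (Fin N) (Fin N) ℂ :=
  Matrix.of fun j k =>
    if 2 ≤ (j : ℕ) + 1 then
      ∑ m ∈ Finset.range (N - ((j : ℕ) + 1) + 1),
        (-1) ^ m * α ^ (M - m) * (M.choose m : ℂ) * u k ^ (-2 * ((m : ℤ) + ((j : ℤ) + 1) - (N : ℤ)))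
    else
      -∑ m ∈ Finset.Icc (max (N - 1) 1) M,
        (-1) ^ m * α ^ (M - m) * (M.choose m : ℂ) * u k ^ (-2 * ((m : ℤ) - (N : ℤ) + 1))

end FiveVertex

end

/-! The weighted sum of wavefunctions is the pairing of the product weight `occWeight` with
`stateKet`, since `B` raises the particle number by one and other patterns drop out. The point is to
let the operators `B` act to the left on this row vector. The weights `α ^ (M - x)` are such that
every `B(u)` preserves the family `lastRow α φ`, in which only the last particle carries a general
function `φ` of its position (`lastRow_vecMul_opB`). The function `φ` then obeys a first-order
recursion with ratio `α * u - u⁻¹ = u * (α - u⁻²)`. Divided differences solve it: each factor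
`B(v_j)` adjoins the node `α - v_j⁻²` to the initial node `α` (`occWeight_vecMul_prod_opB`).
Evaluation on the vacuum leaves the divided difference of `x ^ M`. The determinant gives the same
number. In the variables `z_k = v_k²` all rows of `V` but the last are polynomials of degree at most
the row index, so `det V` is a Vandermonde factor times leading coefficients times a divided
difference of the last row (`det_of_eval_of_last`). The substitution `t = α - 1/z` turns it into the
previous one (`matV_det`). The dual formula follows by transposing the monodromy matrix and
reflecting the sites (`stateBra_eq`). -/

namespace FiveVertex

/-! ### Weights of occupation patterns and the last particle. -/

/-- The position (counted from `1`) of the last particle of a configuration, `0` if it is empty. -/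
def lastPos {M : ℕ} (σ : Fin M → Fin 2) : ℕ :=
  univ.sup fun j => if σ j = 1 then (j : ℕ) + 1 else 0

/-- The product of `α ^ (M - x)` over all particle positions `x`. -/
def occWeight {M : ℕ} (α : ℂ) (σ : Fin M → Fin 2) : ℂ :=
  ∏ j, if σ j = 1 then α ^ (M - (j + 1 : ℕ)) else 1

/-- The product of `α ^ (M - x)` over all particle positions `x` but the last. -/
def bulkWeight {M : ℕ} (α : ℂ) (σ : Fin M → Fin 2) : ℂ :=
  ∏ j, if σ j = 1 ∧ (j : ℕ) + 1 ≠ lastPos σ then α ^ (M - (j + 1 : ℕ)) else 1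

section Config

variable {M : ℕ} {σ : Fin M → Fin 2} {k : Fin M} {α : ℂ}

theorem le_lastPos (h : σ k = 1) : (k : ℕ) + 1 ≤ lastPos σ := by
  have := Finset.le_sup (f := fun j : Fin M => if σ j = 1 then (j : ℕ) + 1 else 0) (mem_univ k)
  simpa [h, lastPos] using this

theorem lastPos_le_iff {n : ℕ} : lastPos σ ≤ n ↔ ∀ j, σ j = 1 → (j : ℕ) + 1 ≤ n := by
  unfold lastPos
  rw [Finset.sup_le_iff]
  refine ⟨fun h j hj => by simpa [hj] using h j (mem_univ j), fun h j _ => ?_⟩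
  split_ifs with hj
  · exact h j hj
  · exact Nat.zero_le _

theorem lastPos_le : lastPos σ ≤ M := lastPos_le_iff.2 fun j _ => j.2

theorem lastPos_ne (h : σ k = 0) : lastPos σ ≠ k + 1 := by
  intro h1
  have h2 : lastPos σ ≤ k := lastPos_le_iff.2 fun j hj => by
    have h3 := le_lastPos hj
    have h4 : j ≠ k := by rintro rfl; simp [h] at hj
    have h5 : (j : ℕ) ≠ k := fun h => h4 (Fin.ext h)
    omega
  omega

theorem lastPos_update_one (σ : Fin M → Fin 2) (k : Fin M) :
    lastPos (Function.update σ k 1) = max (lastPos σ) (k + 1) := by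
  have hk : (k : ℕ) + 1 ≤ lastPos (Function.update σ k 1) := le_lastPos (by simp)
  apply le_antisymm
  · refine lastPos_le_iff.2 fun j hj => ?_
    by_cases hjk : j = k
    · subst hjk; exact le_max_right _ _
    · rw [Function.update_of_ne hjk] at hj
      exact (le_lastPos hj).trans (le_max_left _ _)
  · refine max_le (lastPos_le_iff.2 fun j hj => ?_) hk
    by_cases hjk : j = k
    · subst hjk; exact hk
    · exact le_lastPos (by rwa [Function.update_of_ne hjk])

theorem occWeight_update_one (h : σ k = 0) :
    occWeight α (Function.update σ k 1) = α ^ (M - (k + 1 : ℕ)) * occWeight α σ := by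
  unfold occWeight
  rw [← mul_prod_erase _ _ (mem_univ k), ← mul_prod_erase univ
    (fun j => if σ j = 1 then α ^ (M - (j + 1 : ℕ)) else 1) (mem_univ k)]
  simp only [Function.update_self, h, if_true, zero_ne_one, if_false, one_mul]
  congr 1
  refine prod_congr rfl fun j hj => ?_
  rw [Function.update_of_ne (ne_of_mem_erase hj)]

theorem bulkWeight_update_one_of_lt (h : σ k = 0) (hk : (k : ℕ) + 1 < lastPos σ) :
    bulkWeight α (Function.update σ k 1) = α ^ (M - (k + 1 : ℕ)) * bulkWeight α σ := by
  unfold bulkWeight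
  rw [lastPos_update_one, max_eq_left hk.le, ← mul_prod_erase _ _ (mem_univ k),
    ← mul_prod_erase univ (fun j : Fin M => if σ j = 1 ∧ (j : ℕ) + 1 ≠ lastPos σ then
      α ^ (M - (j + 1 : ℕ)) else 1) (mem_univ k)]
  simp only [Function.update_self, h, zero_ne_one, false_and, if_false, one_mul, true_and,
    if_pos hk.ne]
  congr 1
  refine prod_congr rfl fun j hj => ?_
  rw [Function.update_of_ne (ne_of_mem_erase hj)]

/-- The new particle becomes the last one, so the formerly last particle now carries its full
weight. -/
theorem bulkWeight_update_one_of_le (hk : lastPos σ ≤ k) :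
    bulkWeight α (Function.update σ k 1) = occWeight α σ := by
  unfold bulkWeight occWeight
  rw [lastPos_update_one, max_eq_right (by omega)]
  refine prod_congr rfl fun j _ => ?_
  by_cases hjk : j = k
  · subst hjk
    have : σ j ≠ 1 := fun h => by have := le_lastPos h; omega
    simp [this]
  · have : (j : ℕ) ≠ k := fun h => hjk (Fin.ext h)
    simp [Function.update_of_ne hjk, this]

end Config

/-! ### Passing the auxiliary line through the chain. -/

/-- The row vector on `W ⊗ V^{⊗ M}` obtained after the auxiliary line has passed the sites above
`k`, when it enters with a row vector `bulkWeight σ * φ (lastPos σ)`. -/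
def partialRow {M : ℕ} (α u : ℂ) (φ ψ : ℕ → ℂ) (k : ℕ) (p : Fin 2 × (Fin M → Fin 2)) : ℂ :=
  if p.1 = 0 then
    if k < lastPos p.2 then u ^ (lastPos p.2 - k - 1) * ψ (lastPos p.2) * bulkWeight α p.2
    else u ^ (M - k) * φ (lastPos p.2) * bulkWeight α p.2
  else
    if k < lastPos p.2 then
      α ^ (M - k) * u ^ (lastPos p.2 - k) * ψ (lastPos p.2) * bulkWeight α p.2
    else ψ k * occWeight α p.2

theorem vecMul_lAt {M : ℕ} (α u : ℂ) (r : Fin 2 × (Fin M → Fin 2) → ℂ) (k : Fin M) (b : Fin 2)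
    (σ : Fin M → Fin 2) :
    (r ᵥ* lAt α u k) (b, σ)
      = ∑ a, ∑ s, r (a, Function.update σ k s) * lOperator α u (a, s) (b, σ k) := by
  simp only [vecMul, dotProduct, lAt, of_apply, Fintype.sum_prod_type, mul_ite, mul_zero]
  refine sum_congr rfl fun a _ => ?_
  rw [← sum_filter]
  refine sum_nbij' (fun τ => τ k) (fun s => Function.update σ k s) ?_ ?_ ?_ ?_ ?_
  · simp
  · simp +contextual
  · intro τ hτ
    funext i
    by_cases h : i = k
    · subst h; simp
    · rw [Function.update_of_ne h, (mem_filter.1 hτ).2 i h]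
  · simp
  · intro τ hτ
    congr 3
    funext i
    by_cases h : i = k
    · subst h; simp
    · rw [Function.update_of_ne h, (mem_filter.1 hτ).2 i h]

theorem fin_two_eq_zero_or_one (b : Fin 2) : b = 0 ∨ b = 1 := by omega

/-- The recursion `hψ` collects the two ways to leave an empty site with the auxiliary line occupied
and no particle at that site or above: a last particle sitting there is absorbed, or the occupied
line crosses the empty site with weight `α * u - u⁻¹`. -/
theorem partialRow_vecMul_lAt {M : ℕ} {α u : ℂ} (hu : u ≠ 0) {φ ψ : ℕ → ℂ}
    (hψ : ∀ k < M, ψ k = u ^ (M - k - 1) * φ (k + 1) + (α * u - u⁻¹) * ψ (k + 1)) (k : Fin M) :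
    partialRow α u φ ψ (k + 1) ᵥ* lAt α u k = partialRow (M := M) α u φ ψ k := by
  funext ⟨b, σ⟩
  rw [vecMul_lAt]
  have hk := k.2
  have e1 : M - k = M - (k + 1) + 1 := by omega
  obtain ⟨σ', hσ', h⟩ : ∃ σ' : Fin M → Fin 2, σ' k = 0 ∧
      (σ = σ' ∨ σ = Function.update σ' k 1) := by
    refine ⟨Function.update σ k 0, by simp, ?_⟩
    rcases fin_two_eq_zero_or_one (σ k) with h | h
    · left; rw [← h, Function.update_eq_self]
    · right; rw [Function.update_idem, ← h, Function.update_eq_self]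
  have hne := lastPos_ne hσ'
  have hup : Function.update σ' k 0 = σ' := by rw [← hσ', Function.update_eq_self]
  simp only [Fin.sum_univ_two]
  rcases h with h | h <;> rw [h] <;> rcases fin_two_eq_zero_or_one b with rfl | rfl <;>
    simp [lOperator, kroneckerMap_apply, projEmpty, projOcc, sigmaMinus, sigmaPlus, hσ', hup] <;>
    simp only [partialRow, lastPos_update_one] <;>
    rcases lt_or_ge ((k : ℕ) + 1) (lastPos σ') with hl | hl
  · obtain ⟨d, hd⟩ : ∃ d, lastPos σ' = k + 1 + d + 1 := ⟨lastPos σ' - (k + 1) - 1, by omega⟩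
    have e2 : lastPos σ' - k - 1 = d + 1 := by omega
    have e3 : lastPos σ' - (k + 1) - 1 = d := by omega
    simp [hl, (Nat.lt_succ_self _).trans hl, e2, e3, pow_succ]; ring
  · have : lastPos σ' ≤ k := by omega
    simp [not_lt.2 hl, not_lt.2 this, e1, pow_succ]; ring
  -- This case dictates the weights: the factor `α ^ (M - (k + 1))` of a particle absorbed at this
  -- site cancels the `-u⁻¹` part of the crossing weight.
  · obtain ⟨d, hd⟩ : ∃ d, lastPos σ' = k + 1 + d + 1 := ⟨lastPos σ' - (k + 1) - 1, by omega⟩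
    have e2 : lastPos σ' - k = d + 2 := by omega
    have e3 : lastPos σ' - (k + 1) - 1 = d := by omega
    have e4 : lastPos σ' - (k + 1) = d + 1 := by omega
    have : (k : ℕ) < lastPos σ' := by omega
    simp [hl, this, bulkWeight_update_one_of_lt hσ' hl, e1, e2, e4, pow_succ]
    field_simp
    ring
  · have h2 : lastPos σ' ≤ k := by omega
    have h3 : max (lastPos σ') (k + 1) = k + 1 := by omega
    simp [not_lt.2 hl, not_lt.2 h2, h3, bulkWeight_update_one_of_le h2, hψ k hk, Nat.sub_sub]
    ring
  · have : (k : ℕ) < lastPos σ' := by omega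
    simp [hl, this, bulkWeight_update_one_of_lt hσ' hl, Nat.sub_sub]; ring
  · have h2 : lastPos σ' ≤ k := by omega
    have h3 : max (lastPos σ') (k + 1) = k + 1 := by omega
    simp [not_lt.2 hl, h3, bulkWeight_update_one_of_le h2]
  · have : (k : ℕ) < lastPos σ' := by omega
    obtain ⟨d, hd⟩ : ∃ d, lastPos σ' = k + 1 + d + 1 := ⟨lastPos σ' - (k + 1) - 1, by omega⟩
    have e2 : lastPos σ' - k = d + 2 := by omega
    have e4 : lastPos σ' - (k + 1) = d + 1 := by omega
    simp [hl, this, bulkWeight_update_one_of_lt hσ' hl, e1, e2, e4, pow_succ]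
    ring
  · have h2 : lastPos σ' ≤ k := by omega
    have h3 : max (lastPos σ') (k + 1) = k + 1 := by omega
    simp [h3, bulkWeight_update_one_of_le h2, occWeight_update_one hσ', e1, pow_succ]
    ring

theorem partialRow_vecMul_monodromy {M : ℕ} {α u : ℂ} (hu : u ≠ 0) {φ ψ : ℕ → ℂ}
    (hψ : ∀ k < M, ψ k = u ^ (M - k - 1) * φ (k + 1) + (α * u - u⁻¹) * ψ (k + 1)) :
    partialRow α u φ ψ M ᵥ* monodromy M α u = partialRow (M := M) α u φ ψ 0 := by
  -- The operator of the last site is leftmost in the product and meets the row vector first, so the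
  -- sites are consumed downwards.
  have key : ∀ k ≤ M, partialRow α u φ ψ k ᵥ*
      ((List.ofFn fun j : Fin M => lAt α u j).take k).reverse.prod
        = partialRow (M := M) α u φ ψ 0 := by
    intro k
    induction k with
    | zero => intro _; simp
    | succ k ih =>
      intro hk
      have hk' : k < (List.ofFn fun j : Fin M => lAt α u j).length := by simpa using hk
      rw [List.take_succ_eq_append_getElem hk', List.reverse_append, List.prod_append,
        ← vecMul_vecMul]
      simp only [List.reverse_singleton, List.prod_singleton, List.getElem_ofFn]
      rw [partialRow_vecMul_lAt hu hψ ⟨k, hk⟩]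
      exact ih (by omega)
  have := key M le_rfl
  rwa [List.take_of_length_le (by simp)] at this

/-- The row vector `bulkWeight σ * φ (lastPos σ)`. -/
def lastRow {M : ℕ} (α : ℂ) (φ : ℕ → ℂ) (σ : Fin M → Fin 2) : ℂ :=
  φ (lastPos σ) * bulkWeight α σ

theorem occWeight_eq_bulkWeight {M : ℕ} (α : ℂ) {σ : Fin M → Fin 2} (h : lastPos σ = 0) :
    occWeight α σ = bulkWeight α σ := by
  refine prod_congr rfl fun j _ => ?_
  simp [h]

/-- The line enters empty, which forces `ψ M = 0`, and leaves occupied. The value at `a = 0` is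
exceptional because with no particle present the factor `α ^ M` does not arise. -/
theorem lastRow_vecMul_opB {M : ℕ} {α u : ℂ} (hu : u ≠ 0) {φ ψ : ℕ → ℂ} (hM : ψ M = 0)
    (hψ : ∀ k < M, ψ k = u ^ (M - k - 1) * φ (k + 1) + (α * u - u⁻¹) * ψ (k + 1)) :
    lastRow α φ ᵥ* opB M α u
      = lastRow α fun a => if a = 0 then ψ 0 else α ^ M * u ^ a * ψ a := by
  funext σ
  have h := congrFun (partialRow_vecMul_monodromy (M := M) hu hψ) (1, σ)
  have h0 : ∀ τ : Fin M → Fin 2, partialRow α u φ ψ M (0, τ) = lastRow α φ τ := fun τ => by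
    simp [partialRow, lastRow, lastPos_le]
  have h1 : ∀ τ : Fin M → Fin 2, partialRow α u φ ψ M (1, τ) = 0 := fun τ => by
    simp [partialRow, lastPos_le, hM]
  simp only [vecMul, dotProduct, Fintype.sum_prod_type, Fin.sum_univ_two, h0, h1, zero_mul,
    sum_const_zero, add_zero] at h
  rw [show (lastRow α φ ᵥ* opB M α u) σ = _ from h]
  rcases Nat.eq_zero_or_pos (lastPos σ) with h2 | h2
  · simp [partialRow, lastRow, h2, occWeight_eq_bulkWeight]
  · simp [partialRow, lastRow, h2, h2.ne']

/-! ### Divided differences and the iterated action of `B`. -/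

/-- The divided difference of `f` at the points of `S`. -/
noncomputable def dividedDiff (S : Finset ℂ) (f : ℂ → ℂ) : ℂ :=
  ∑ x ∈ S, f x / ∏ y ∈ S.erase x, (x - y)

theorem dividedDiff_eval {S : Finset ℂ} {P : Polynomial ℂ} (hP : P.degree < #S) :
    dividedDiff S (fun x => P.eval x) = P.coeff (#S - 1) :=
  (Lagrange.coeff_eq_sum (v := id) Function.injective_id.injOn hP).symm

theorem dividedDiff_const {S : Finset ℂ} (hS : 2 ≤ #S) (c : ℂ) :
    dividedDiff S (fun _ => c) = 0 := by
  have h := dividedDiff_eval (S := S) (P := Polynomial.C c)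
    (Polynomial.degree_C_le.trans_lt (by exact_mod_cast (by omega : 0 < #S)))
  simpa [Polynomial.coeff_C, show #S - 1 ≠ 0 by omega] using h

theorem dividedDiff_add (S : Finset ℂ) (f g : ℂ → ℂ) :
    dividedDiff S (fun x => f x + g x) = dividedDiff S f + dividedDiff S g := by
  simp only [dividedDiff, add_div, sum_add_distrib]

theorem dividedDiff_mul (S : Finset ℂ) (c : ℂ) (f : ℂ → ℂ) :
    dividedDiff S (fun x => c * f x) = c * dividedDiff S f := by
  simp only [dividedDiff, mul_sum, mul_div_assoc]

theorem dividedDiff_insert_sub_mul {S : Finset ℂ} {c : ℂ} (hc : c ∉ S) (g : ℂ → ℂ) :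
    dividedDiff (insert c S) (fun x => (x - c) * g x) = dividedDiff S g := by
  unfold dividedDiff
  rw [sum_insert hc]
  simp only [sub_self, zero_mul, zero_div, zero_add]
  refine sum_congr rfl fun x hx => ?_
  have hxc : x ≠ c := fun h => hc (h ▸ hx)
  rw [erase_insert_of_ne (Ne.symm hxc), prod_insert (fun h => hc (mem_of_mem_erase h)),
    mul_div_mul_left _ _ (sub_ne_zero.2 hxc)]

/-- From `x ^ (m + 1) = (x - c) * x ^ m + c * x ^ m`. With `c = α - u⁻²` this is the recursion for
`ψ` after removal of powers of `u`. -/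
theorem dividedDiff_insert_pow_succ {S : Finset ℂ} {c : ℂ} (hc : c ∉ S) (m : ℕ) :
    dividedDiff (insert c S) (fun x => x ^ (m + 1))
      = dividedDiff S (fun x => x ^ m) + c * dividedDiff (insert c S) (fun x => x ^ m) := by
  rw [← dividedDiff_insert_sub_mul hc, ← dividedDiff_mul, ← dividedDiff_add]
  congr 1
  funext x
  ring

/-- The points `α` and `α - v_j⁻²`. -/
noncomputable def spectralNodes {N : ℕ} (α : ℂ) (v : Fin N → ℂ) : Finset ℂ :=
  insert α (univ.image fun j => α - (v j ^ 2)⁻¹)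

theorem spectralNodes_succ {N : ℕ} (α : ℂ) (v : Fin (N + 1) → ℂ) :
    spectralNodes α v = insert (α - (v (Fin.last N) ^ 2)⁻¹)
      (spectralNodes α fun j => v j.castSucc) := by
  ext x
  simp only [spectralNodes, mem_insert, mem_image, mem_univ, true_and, Fin.exists_fin_succ',
    eq_comm (a := x)]
  tauto

theorem occWeight_eq_lastRow {M : ℕ} (α : ℂ) (σ : Fin M → Fin 2) :
    occWeight α σ = lastRow α (fun a => if a = 0 then 1 else α ^ (M - a)) σ := by
  unfold lastRow
  dsimp only
  rcases Nat.eq_zero_or_pos (lastPos σ) with h | h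
  · rw [if_pos h, one_mul, occWeight_eq_bulkWeight α h]
  · obtain ⟨k, hk, hkl⟩ : ∃ k, σ k = 1 ∧ lastPos σ = k + 1 := by
      by_contra! hcon
      have : lastPos σ ≤ lastPos σ - 1 := lastPos_le_iff.2 fun j hj => by
        have h1 := hcon j hj
        have h2 := le_lastPos hj
        omega
      omega
    rw [if_neg h.ne', occWeight, bulkWeight, ← mul_prod_erase _ _ (mem_univ k),
      ← mul_prod_erase univ (fun j : Fin M => if σ j = 1 ∧ (j : ℕ) + 1 ≠ lastPos σ then
      α ^ (M - (j + 1 : ℕ)) else 1) (mem_univ k)]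
    simp only [hk, hkl, if_true, ne_eq, not_true, and_false, if_false, one_mul]
    congr 1
    refine prod_congr rfl fun j hj => ?_
    have : (j : ℕ) ≠ k := fun h => ne_of_mem_erase hj (Fin.ext h)
    simp [this]

/-- Induction on `N`, splitting off the rightmost operator. Only the values of `φ` at `a ≠ 0` feed
the next step; `φ 0` has one factor `α ^ M` fewer and is what the vacuum reads off. -/
theorem occWeight_vecMul_prod_opB (M : ℕ) (α : ℂ) : ∀ {N : ℕ} (v : Fin N → ℂ), (∀ j, v j ≠ 0) →
    (∀ j k, j ≠ k → v j ^ 2 ≠ v k ^ 2) →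
    ∃ φ : ℕ → ℂ,
      occWeight (M := M) α ᵥ* (List.ofFn fun j => opB M α (v j)).prod = lastRow α φ ∧
      (∀ a, a ≠ 0 → φ a = α ^ (M * N) * (∏ j, v j ^ (M + 1) * (v j ^ 2)⁻¹)
        * dividedDiff (spectralNodes α v) fun x => x ^ (M - a)) ∧
      φ 0 = if N = 0 then 1 else α ^ (M * (N - 1)) * (∏ j, v j ^ (M + 1) * (v j ^ 2)⁻¹)
        * dividedDiff (spectralNodes α v) fun x => x ^ M
  | 0, v, _, _ => by
    refine ⟨fun a => if a = 0 then 1 else α ^ (M - a), ?_, ?_, ?_⟩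
    · simp only [List.ofFn_zero, List.prod_nil, vecMul_one]
      exact funext (occWeight_eq_lastRow α)
    · intro a ha
      simp [ha, spectralNodes, dividedDiff]
    · simp
  | N + 1, v, hv, hd => by
    obtain ⟨φ, h1, h2, -⟩ := occWeight_vecMul_prod_opB M α (fun j : Fin N => v j.castSucc)
      (fun j => hv _) (fun j k hjk => hd _ _ (by simpa using hjk))
    have hu := hv (Fin.last N)
    have hnot : α - (v (Fin.last N) ^ 2)⁻¹ ∉ spectralNodes α fun j : Fin N => v j.castSucc := by
      simp only [spectralNodes, mem_insert, mem_image, mem_univ, true_and, not_or, not_exists]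
      refine ⟨by simpa using hu, fun j hj => ?_⟩
      exact hd _ _ (Fin.castSucc_lt_last j).ne (inv_injective (sub_right_injective hj))
    have hcard : 2 ≤ #(spectralNodes α v) := by
      rw [spectralNodes_succ, card_insert_of_notMem hnot]
      have : 0 < #(spectralNodes α fun j : Fin N => v j.castSucc) :=
        card_pos.2 (insert_nonempty _ _)
      omega
    set u := v (Fin.last N) with hu_def
    set D : ℂ := ∏ j : Fin N, v j.castSucc ^ (M + 1) * (v j.castSucc ^ 2)⁻¹ with hD
    have hDs : ∏ j, v j ^ (M + 1) * (v j ^ 2)⁻¹ = D * (u ^ (M + 1) * (u ^ 2)⁻¹) := by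
      rw [Fin.prod_univ_castSucc]
    -- The prefactor is `u ^ (M - 1 - k)`, written as a quotient because the exponent is `-1` at `k
    -- = M`.
    set ψ : ℕ → ℂ := fun k => u ^ (M + 1) / u ^ (k + 2) * (α ^ (M * N) * D
      * dividedDiff (spectralNodes α v) fun x => x ^ (M - k)) with hψ
    refine ⟨fun a => if a = 0 then ψ 0 else α ^ M * u ^ a * ψ a, ?_, ?_, ?_⟩
    · rw [List.ofFn_succ_last, List.prod_append, ← vecMul_vecMul, h1, List.prod_singleton]
      refine lastRow_vecMul_opB hu ?_ ?_
      -- At `k = M` the function is constant, and there are at least two nodes.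
      · simp [hψ, dividedDiff_const hcard]
      · intro k hk
        obtain ⟨d, rfl⟩ : ∃ d, M = k + 1 + d := ⟨M - (k + 1), by omega⟩
        have e2 : k + 1 + d - k = d + 1 := by omega
        have e3 : k + 1 + d - (k + 1) = d := by omega
        simp only [hψ, h2 (k + 1) (Nat.succ_ne_zero k), e2, e3,
          Nat.add_sub_cancel]
        rw [spectralNodes_succ, dividedDiff_insert_pow_succ hnot, ← hu_def]
        generalize dividedDiff (insert _ _) _ = X
        field_simp
        ring
    · intro a ha
      simp only [ha, if_false, hψ, hDs]
      rw [Nat.mul_succ, pow_add]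
      field_simp
      ring
    · simp only [if_true, hψ, hDs, Nat.succ_ne_zero, if_false, Nat.add_sub_cancel, Nat.sub_zero,
        zero_add]
      ring

theorem occWeight_dotProduct_stateKet (M : ℕ) {N : ℕ} (α : ℂ) (v : Fin N → ℂ) (hv : ∀ j, v j ≠ 0)
    (hd : ∀ j k, j ≠ k → v j ^ 2 ≠ v k ^ 2) :
    occWeight α ⬝ᵥ stateKet M α v =
      if N = 0 then 1 else α ^ (M * (N - 1)) * (∏ j, v j ^ (M + 1) * (v j ^ 2)⁻¹)
        * dividedDiff (spectralNodes α v) fun x => x ^ M := by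
  obtain ⟨φ, h1, -, h3⟩ := occWeight_vecMul_prod_opB M α v hv hd
  rw [stateKet, dotProduct_mulVec, h1, ← h3, vacuum, dotProduct_single, mul_one, lastRow]
  have h0 : lastPos (fun _ : Fin M => (0 : Fin 2)) = 0 :=
    Nat.le_zero.1 (lastPos_le_iff.2 fun j hj => by simp at hj)
  rw [h0]
  simp [bulkWeight]

/-! ### Configuration states and conservation of particle number. -/

/-- The occupation pattern of the particle configuration `x`. -/
def occupation {M N : ℕ} (x : Fin N → Fin M) : Fin M → Fin 2 :=
  fun i => if ∃ j, x j = i then 1 else 0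

theorem occupation_eq_one {M N : ℕ} {x : Fin N → Fin M} {i : Fin M} :
    occupation x i = 1 ↔ ∃ j, x j = i := by
  unfold occupation
  split_ifs with h <;> simp [h]

theorem single_vecMul_atSite_sigmaPlus {M : ℕ} {τ : Fin M → Fin 2} {k : Fin M} (h : τ k = 0) :
    Pi.single τ (1 : ℂ) ᵥ* atSite sigmaPlus k = Pi.single (Function.update τ k 1) 1 := by
  rw [single_one_vecMul]
  funext σ
  rw [row_apply, atSite, of_apply, Pi.single_apply]
  by_cases h1 : ∀ i, i ≠ k → τ i = σ i
  · rw [if_pos h1, h]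
    rcases fin_two_eq_zero_or_one (σ k) with h2 | h2
    · rw [if_neg, h2]
      · simp [sigmaPlus]
      · intro h3; rw [h3] at h2; simp at h2
    · rw [if_pos, h2]
      · simp [sigmaPlus]
      · funext i
        by_cases hi : i = k
        · subst hi; simp [h2]
        · rw [Function.update_of_ne hi, h1 i hi]
  · rw [if_neg h1, if_neg]
    rintro rfl
    exact h1 fun i hi => by rw [Function.update_of_ne hi]

theorem configBra_eq_single {M : ℕ} : ∀ {N : ℕ} (x : Fin N → Fin M), Function.Injective x →
    configBra x = Pi.single (occupation x) 1
  | 0, x, _ => by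
    simp only [configBra, List.ofFn_zero, List.prod_nil, vecMul_one, vacuum]
    congr 1
  | N + 1, x, hx => by
    have ih := configBra_eq_single (fun j : Fin N => x j.castSucc)
      (hx.comp (Fin.castSucc_injective N))
    rw [configBra] at ih ⊢
    rw [List.ofFn_succ_last, List.prod_append, ← vecMul_vecMul, ih, List.prod_singleton,
      single_vecMul_atSite_sigmaPlus]
    · congr 1
      funext i
      by_cases hi : i = x (Fin.last N)
      · subst hi
        rw [Function.update_self]
        exact (occupation_eq_one.2 ⟨_, rfl⟩).symm
      · rw [Function.update_of_ne hi]
        simp [occupation, Fin.exists_fin_succ', Ne.symm hi]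
    · refine if_neg ?_
      rintro ⟨j, hj⟩
      exact (Fin.castSucc_lt_last j).ne (hx hj)

theorem atSite_sigmaMinus_eq_transpose {M : ℕ} (k : Fin M) :
    atSite sigmaMinus k = (atSite sigmaPlus k)ᵀ := by
  ext τ σ
  simp only [atSite, of_apply, transpose_apply]
  have h1 : sigmaMinus (τ k) (σ k) = sigmaPlus (σ k) (τ k) := by
    rcases fin_two_eq_zero_or_one (τ k) with h | h <;>
      rcases fin_two_eq_zero_or_one (σ k) with h' | h' <;> simp [h, h', sigmaMinus, sigmaPlus]
  rw [h1]
  simp only [eq_comm]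

theorem list_reverse_ofFn {A : Type*} {n : ℕ} (f : Fin n → A) :
    (List.ofFn f).reverse = List.ofFn fun i => f i.rev := by
  apply List.ext_getElem
  · simp
  · intro i h1 h2
    simp only [List.getElem_reverse, List.getElem_ofFn, List.length_ofFn]
    congr 1
    ext
    simp [Fin.rev]
    omega

theorem configKet_eq_configBra {M N : ℕ} (x : Fin N → Fin M) :
    configKet x = configBra fun j => x j.rev := by
  rw [configKet, configBra, ← vecMul_transpose, transpose_list_prod, List.map_ofFn,
    list_reverse_ofFn]
  simp [atSite_sigmaMinus_eq_transpose]

theorem occupation_comp_rev {M N : ℕ} (x : Fin N → Fin M) :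
    occupation (fun j => x j.rev) = occupation x := by
  funext i
  simp only [occupation, ← Fin.rev_surjective.exists (p := fun j => x j = i)]

theorem wave_eq {M N : ℕ} (α : ℂ) {x : Fin N → Fin M} (hx : Function.Injective x)
    (v : Fin N → ℂ) : wave α x v = stateKet M α v (occupation x) := by
  rw [wave, configBra_eq_single x hx, single_one_dotProduct]

theorem dualWave_eq {M N : ℕ} (α : ℂ) {x : Fin N → Fin M} (hx : Function.Injective x)
    (u : Fin N → ℂ) : dualWave α u x = stateBra M α u (occupation x) := by
  rw [dualWave, configKet_eq_configBra, configBra_eq_single (fun j => x j.rev) (hx.comp Fin.rev_injective),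
    dotProduct_single_one, occupation_comp_rev]

/-- The number of particles of a configuration. -/
def particleNumber {M : ℕ} (σ : Fin M → Fin 2) : ℕ := ∑ j, (σ j : ℕ)

theorem lOperator_ne_zero {α u : ℂ} {a s b t : Fin 2} (h : lOperator α u (a, s) (b, t) ≠ 0) :
    (a : ℕ) + s = b + t := by
  revert h
  rcases fin_two_eq_zero_or_one a with rfl | rfl <;>
    rcases fin_two_eq_zero_or_one s with rfl | rfl <;>
    rcases fin_two_eq_zero_or_one b with rfl | rfl <;>
    rcases fin_two_eq_zero_or_one t with rfl | rfl <;>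
    simp [lOperator, kroneckerMap_apply, projEmpty, projOcc, sigmaMinus, sigmaPlus]

theorem lAt_ne_zero {M : ℕ} {α u : ℂ} {k : Fin M} {p q : Fin 2 × (Fin M → Fin 2)}
    (h : lAt α u k p q ≠ 0) : (p.1 : ℕ) + particleNumber p.2 = q.1 + particleNumber q.2 := by
  rw [lAt, of_apply] at h
  split_ifs at h with h1
  · have h2 := lOperator_ne_zero h
    have h3 : ∑ j ∈ univ.erase k, (p.2 j : ℕ) = ∑ j ∈ univ.erase k, (q.2 j : ℕ) :=
      sum_congr rfl fun j hj => by rw [h1 j (ne_of_mem_erase hj)]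
    rw [particleNumber, particleNumber, ← add_sum_erase _ _ (mem_univ k),
      ← add_sum_erase univ (fun j => (q.2 j : ℕ)) (mem_univ k), h3]
    omega
  · exact absurd rfl h

theorem list_prod_ne_zero_of_preserves {ι : Type*} [Fintype ι] [DecidableEq ι] {w : ι → ℕ} :
    ∀ {l : List (Matrix ι ι ℂ)}, (∀ A ∈ l, ∀ p q, A p q ≠ 0 → w p = w q) →
      ∀ p q, l.prod p q ≠ 0 → w p = w q
  | [], _, p, q, h => by
    rw [List.prod_nil, one_apply] at h
    rw [(ite_ne_right_iff.1 h).1]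
  | A :: l, hA, p, q, h => by
    rw [List.prod_cons, mul_apply] at h
    obtain ⟨r, -, hr⟩ := exists_ne_zero_of_sum_ne_zero h
    exact (hA A List.mem_cons_self p r (left_ne_zero_of_mul hr)).trans
      (list_prod_ne_zero_of_preserves (fun B hB => hA B (List.mem_cons_of_mem _ hB)) r q
        (right_ne_zero_of_mul hr))

theorem opB_ne_zero {M : ℕ} {α u : ℂ} {τ σ : Fin M → Fin 2} (h : opB M α u τ σ ≠ 0) :
    particleNumber τ = particleNumber σ + 1 := by
  have := list_prod_ne_zero_of_preserves (w := fun p : Fin 2 × (Fin M → Fin 2) =>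
    (p.1 : ℕ) + particleNumber p.2) (l := (List.ofFn fun j : Fin M => lAt α u j).reverse)
    (by
      intro A hA p q
      obtain ⟨j, rfl⟩ := List.mem_ofFn.1 (List.mem_reverse.1 hA)
      exact lAt_ne_zero) (0, τ) (1, σ) h
  simp at this
  omega

theorem stateKet_ne_zero {M : ℕ} {α : ℂ} : ∀ {N : ℕ} {v : Fin N → ℂ} {σ : Fin M → Fin 2},
    stateKet M α v σ ≠ 0 → particleNumber σ = N
  | 0, v, σ, h => by
    simp only [stateKet, List.ofFn_zero, List.prod_nil, one_mulVec, vacuum, Pi.single_apply] at h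
    rw [(ite_ne_right_iff.1 h).1]
    simp [particleNumber]
  | N + 1, v, σ, h => by
    rw [stateKet, List.ofFn_succ, List.prod_cons, ← mulVec_mulVec] at h
    obtain ⟨τ, -, hτ⟩ := exists_ne_zero_of_sum_ne_zero h
    have h1 := opB_ne_zero (left_ne_zero_of_mul hτ)
    have h2 : particleNumber τ = N :=
      stateKet_ne_zero (v := fun j => v j.succ) (right_ne_zero_of_mul hτ)
    omega

theorem exists_occupation_eq {M N : ℕ} {σ : Fin M → Fin 2} (h : particleNumber σ = N) :
    ∃ x : Fin N → Fin M, StrictMono x ∧ occupation x = σ := by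
  have hc : #(univ.filter fun j => σ j = 1) = N := by
    rw [← h, particleNumber, card_filter]
    refine sum_congr rfl fun j _ => ?_
    rcases fin_two_eq_zero_or_one (σ j) with h | h <;> simp [h]
  refine ⟨_, (orderEmbOfFin _ hc).strictMono, funext fun i => ?_⟩
  have h1 := occupation_eq_one (x := orderEmbOfFin _ hc) (i := i)
  rw [← Set.mem_range, range_orderEmbOfFin, mem_coe, mem_filter] at h1
  have h2 := fin_two_eq_zero_or_one (σ i)
  have h3 := fin_two_eq_zero_or_one (occupation (orderEmbOfFin _ hc) i)
  simp only [mem_univ, true_and] at h1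
  rcases h2 with h2 | h2
  · rw [h2] at h1 ⊢
    exact h3.resolve_right fun h => by simpa using h1.1 h
  · rw [h2]; exact h1.2 h2

theorem mem_configurations {M N : ℕ} {x : Fin N → Fin M} :
    x ∈ configurations M N ↔ StrictMono x := by
  simp [configurations]

theorem occupation_injOn {M N : ℕ} :
    Set.InjOn (occupation (M := M) (N := N)) (configurations M N) := by
  intro x hx y hy h
  refine (StrictMono.range_inj (mem_configurations.1 hx) (mem_configurations.1 hy)).1 ?_
  ext i
  rw [Set.mem_range, Set.mem_range, ← occupation_eq_one, ← occupation_eq_one, h]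

theorem sum_sub_eq {M N : ℕ} (x : Fin N → Fin M) :
    (∑ j, (M - ((x j : ℕ) + 1))) + posSum x = M * N := by
  rw [posSum, ← sum_add_distrib, sum_congr rfl fun j _ => Nat.sub_add_cancel (x j).2]
  simp [mul_comm]

theorem occWeight_occupation {M N : ℕ} (α : ℂ) {x : Fin N → Fin M} (hx : Function.Injective x) :
    occWeight α (occupation x) = α ^ (M * N - posSum x) := by
  rw [← Nat.eq_sub_of_add_eq (sum_sub_eq x), ← prod_pow_eq_pow_sum, occWeight, ← prod_filter,
    ← prod_image (s := univ) (g := x) (f := fun i : Fin M => α ^ (M - ((i : ℕ) + 1)))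
      hx.injOn]
  congr 1
  ext i
  simp [occupation_eq_one]

/-- Patterns without exactly `N` particles have zero amplitude, so the sum over configurations may
run over all patterns. -/
theorem sum_configurations_wave (M : ℕ) {N : ℕ} (α : ℂ) (v : Fin N → ℂ) :
    ∑ x ∈ configurations M N, α ^ (M * N - posSum x) * wave α x v
      = occWeight α ⬝ᵥ stateKet M α v := by
  classical
  rw [dotProduct, ← sum_subset (subset_univ ((configurations M N).image occupation)),
    sum_image occupation_injOn]
  · refine sum_congr rfl fun x hx => ?_
    have hi := (mem_configurations.1 hx).injective
    rw [occWeight_occupation α hi, wave_eq α hi]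
  · intro σ _ hσ
    by_contra hne
    obtain ⟨x, hx, rfl⟩ := exists_occupation_eq (stateKet_ne_zero (right_ne_zero_of_mul hne))
    exact hσ (mem_image_of_mem _ (mem_configurations.2 hx))

/-! ### Transposition and reflection of the sites. -/

theorem lOperator_symm (α u : ℂ) (p q : Fin 2 × Fin 2) :
    lOperator α u p q = lOperator α u q p := by
  obtain ⟨a, s⟩ := p
  obtain ⟨b, t⟩ := q
  rcases fin_two_eq_zero_or_one a with rfl | rfl <;>
    rcases fin_two_eq_zero_or_one s with rfl | rfl <;>
    rcases fin_two_eq_zero_or_one b with rfl | rfl <;>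
    rcases fin_two_eq_zero_or_one t with rfl | rfl <;>
    simp [lOperator, kroneckerMap_apply, projEmpty, projOcc, sigmaMinus, sigmaPlus]

/-- The reflection of the sites. -/
def reflect (M : ℕ) : (Fin M → Fin 2) ≃ (Fin M → Fin 2) :=
  Equiv.arrowCongr Fin.revPerm (Equiv.refl _)

theorem reflect_apply {M : ℕ} (σ : Fin M → Fin 2) (i : Fin M) : reflect M σ i = σ i.rev := rfl

theorem lAt_transpose {M : ℕ} (α u : ℂ) (k : Fin M) :
    (lAt α u k)ᵀ = reindexAlgEquiv ℂ ℂ ((Equiv.refl (Fin 2)).prodCongr (reflect M))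
      (lAt α u k.rev) := by
  ext ⟨a, τ⟩ ⟨b, σ⟩
  rw [transpose_apply, lAt, of_apply, lOperator_symm]
  have hs : ((Equiv.refl (Fin 2)).prodCongr (reflect M)).symm
    = (Equiv.refl (Fin 2)).prodCongr (reflect M) := rfl
  simp only [coe_reindexAlgEquiv, reindex_apply, submatrix_apply, lAt, of_apply, hs,
    Equiv.prodCongr_apply, Prod.map_apply, Equiv.refl_apply, reflect_apply, Fin.rev_rev]
  refine if_congr ?_ rfl rfl
  rw [Fin.rev_surjective.forall (p := fun i => i ≠ k → σ i = τ i)]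
  refine forall_congr' fun i => ?_
  rw [eq_comm (a := σ i.rev), ne_eq, ne_eq, Fin.rev_eq_iff]

theorem monodromy_transpose (M : ℕ) (α u : ℂ) :
    (monodromy M α u)ᵀ = reindexAlgEquiv ℂ ℂ ((Equiv.refl (Fin 2)).prodCongr (reflect M))
      (monodromy M α u) := by
  rw [monodromy, transpose_list_prod, map_list_prod, List.map_reverse, List.reverse_reverse,
    List.map_ofFn, list_reverse_ofFn, List.map_ofFn]
  simp only [Function.comp_def, lAt_transpose]

theorem opC_transpose (M : ℕ) (α u : ℂ) :
    (opC M α u)ᵀ = reindexAlgEquiv ℂ ℂ (reflect M) (opB M α u) := by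
  ext τ σ
  have h := congrFun (congrFun (monodromy_transpose M α u) (0, τ)) (1, σ)
  exact h

/-- The `L`-operator is symmetric, so transposition only reverses the order of the sites. It
exchanges `C` with the reflected `B` and reverses the order of the spectral parameters. -/
theorem stateBra_eq (M : ℕ) {N : ℕ} (α : ℂ) (u : Fin N → ℂ) (σ : Fin M → Fin 2) :
    stateBra M α u σ = stateKet M α (fun j => u j.rev) (reflect M σ) := by
  have hp : (List.ofFn fun j : Fin N => opC M α (u j)).prodᵀ
      = reindexAlgEquiv ℂ ℂ (reflect M) (List.ofFn fun j : Fin N => opB M α (u j.rev)).prod := by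
    rw [transpose_list_prod, map_list_prod, List.map_ofFn, list_reverse_ofFn, List.map_ofFn]
    simp only [Function.comp_def, opC_transpose]
  rw [stateBra, ← mulVec_transpose, hp, stateKet]
  have hv : vacuum M ∘ reflect M = vacuum M := by
    funext τ
    simp only [vacuum, Function.comp_apply, Pi.single_apply]
    congr 1
    rw [eq_iff_iff]
    exact ⟨fun h => funext fun i => by
      simpa [reflect_apply] using congrFun h i.rev, fun h => by rw [h]; rfl⟩
  rw [coe_reindexAlgEquiv, reindex_apply, submatrix_mulVec_equiv, Equiv.symm_symm, hv]
  rfl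

theorem occupation_reflect {M N : ℕ} (x : Fin N → Fin M) :
    occupation (fun j => (x j.rev).rev) = reflect M (occupation x) := by
  funext i
  rw [occupation_comp_rev (fun j => (x j).rev), reflect_apply]
  simp only [occupation, Fin.rev_eq_iff]

theorem sum_configurations_dualWave (M : ℕ) {N : ℕ} (α : ℂ) (u : Fin N → ℂ) :
    ∑ x ∈ configurations M N, α ^ (posSum x - N) * dualWave α u x
      = ∑ x ∈ configurations M N, α ^ (M * N - posSum x) * wave α x fun j => u j.rev := by
  have hmem : ∀ x ∈ configurations M N, (fun j => (x j.rev).rev) ∈ configurations M N := by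
    intro x hx
    rw [mem_configurations] at hx ⊢
    exact fun i j hij => Fin.rev_lt_rev.2 (hx (Fin.rev_lt_rev.2 hij))
  refine sum_nbij' (fun x j => (x j.rev).rev) (fun x j => (x j.rev).rev) hmem hmem
    (by simp) (by simp) ?_
  intro x hx
  have hi := (mem_configurations.1 hx).injective
  have hi' := (mem_configurations.1 (hmem x hx)).injective
  rw [dualWave_eq α hi, wave_eq α hi', stateBra_eq, occupation_reflect]
  congr 2
  -- The reflection sends a position `x` to `M + 1 - x`, so `M - x` becomes `x - 1`, which matches
  -- the two exponents.
  rw [← Nat.eq_sub_of_add_eq (sum_sub_eq _)]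
  rw [← Equiv.sum_comp Fin.revPerm, posSum, sum_add_distrib]
  simp only [Fin.revPerm_apply, Fin.rev_rev, Fin.val_rev]
  simp only [sum_const, card_univ, Fintype.card_fin, smul_eq_mul, mul_one, Nat.add_sub_cancel]
  refine sum_congr rfl fun j _ => ?_
  have := (x j).2
  omega

/-! ### Evaluation of the determinant of `V`. -/

theorem dividedDiff_image {N : ℕ} {z : Fin N → ℂ} (hz : Function.Injective z) (f : ℂ → ℂ) :
    dividedDiff (univ.image z) f = ∑ k, f (z k) / ∏ j ∈ univ.erase k, (z k - z j) := by
  rw [dividedDiff, sum_image hz.injOn]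
  refine sum_congr rfl fun k _ => ?_
  rw [← image_erase hz, prod_image hz.injOn]

/-- A matrix whose rows but the last are the values of polynomials of degree at most the row index
has its determinant given by a divided difference of the last row. -/
theorem det_of_eval_of_last {n : ℕ} {z : Fin (n + 1) → ℂ} (hz : Function.Injective z)
    (p : Fin n → Polynomial ℂ) (hp : ∀ j, (p j).natDegree ≤ j) (f : ℂ → ℂ)
    (A : Matrix (Fin (n + 1)) (Fin (n + 1)) ℂ)
    (hA : ∀ j k, A (Fin.castSucc j) k = (p j).eval (z k)) (hl : ∀ k, A (Fin.last n) k = f (z k)) :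
    A.det = (∏ j, ∏ k ∈ Ioi j, (z k - z j)) * ((∏ j : Fin n, (p j).coeff j)
      * dividedDiff (univ.image z) f) := by
  set S := univ.image z with hS
  have hcard : #S = n + 1 := by rw [hS, card_image_of_injective _ hz]; simp
  -- Replacing `f` by its interpolant makes every row polynomial. The matrix is then, up to
  -- transposition, Vandermonde times a triangular matrix of coefficients, whose last diagonal entry
  -- is the divided difference.
  set Q := Lagrange.interpolate S id f with hQ
  have hQe : ∀ x ∈ S, Q.eval x = f x := fun x hx =>
    Lagrange.eval_interpolate_at_node (v := id) f Function.injective_id.injOn hx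
  have hQd : Q.degree < #S := Lagrange.degree_interpolate_lt f Function.injective_id.injOn
  have hQc : Q.coeff n = dividedDiff S f := by
    have := dividedDiff_eval hQd
    rw [hcard, Nat.add_sub_cancel] at this
    rw [← this]
    exact sum_congr rfl fun x hx => by dsimp only; rw [hQe x hx]
  have hQn : Q.natDegree ≤ n := by
    rw [hcard] at hQd
    exact Polynomial.natDegree_le_of_degree_le (Order.le_of_lt_succ hQd)
  have hP : ∀ j : Fin (n + 1), (Fin.snoc (α := fun _ => Polynomial ℂ) p Q j).natDegree ≤ j := by
    intro j
    induction j using Fin.lastCases with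
    | last => simpa using hQn
    | cast j => simpa using hp j
  have hAe : Aᵀ = vandermonde z
      * of fun i j : Fin (n + 1) => (Fin.snoc (α := fun _ => Polynomial ℂ) p Q j).coeff i := by
    rw [← eval_matrixOfPolynomials_eq_vandermonde_mul_matrixOfPolynomials z _ hP]
    ext k j
    induction j using Fin.lastCases with
    | last => simp [hl, hQe _ (mem_image_of_mem z (mem_univ k))]
    | cast j => simp [hA]
  rw [← det_transpose, hAe, det_mul, det_vandermonde,
    det_of_isUpperTriangular (matrixOfPolynomials_blockTriangular _ hP)]
  congr 1
  rw [Fin.prod_univ_castSucc]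
  simp [hQc]

/-- The change of variables `z = 1 / (α - t)` in a divided difference. -/
theorem dividedDiff_inv {n : ℕ} {z : Fin (n + 1) → ℂ} (hz : Function.Injective z)
    (h0 : ∀ k, z k ≠ 0) (α : ℂ) (f : ℂ → ℂ) :
    dividedDiff (univ.image z) (fun x => x ^ n * ((α - x⁻¹ - α) * f (α - x⁻¹)))
      = -(∏ j, (z j)⁻¹) * dividedDiff (univ.image fun k => α - (z k)⁻¹) f := by
  have hinj : Function.Injective fun k => α - (z k)⁻¹ := fun i j h =>
    hz (inv_injective (sub_right_injective h))
  rw [dividedDiff_image hz, dividedDiff_image hinj, mul_sum]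
  refine sum_congr rfl fun k _ => ?_
  -- Each factor satisfies `z_k - z_j = z_k * z_j * (t_k - t_j)` with `t = α - 1/z`; the `n` copies
  -- of `z_k` cancel `x ^ n`.
  have h1 : ∏ j ∈ univ.erase k, (z k - z j)
      = z k ^ n * (∏ j ∈ univ.erase k, z j)
        * ∏ j ∈ univ.erase k, (α - (z k)⁻¹ - (α - (z j)⁻¹)) := by
    have h2 : z k ^ n = ∏ j ∈ univ.erase k, z k := by simp
    rw [h2, ← prod_mul_distrib, ← prod_mul_distrib]
    refine prod_congr rfl fun j _ => ?_
    have := h0 j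
    have := h0 k
    field_simp
    ring
  have h3 : ∏ j ∈ univ.erase k, z j ≠ 0 := prod_ne_zero_iff.2 fun j _ => h0 j
  have h4 := h0 k
  rw [h1, ← mul_prod_erase _ _ (mem_univ k), prod_inv_distrib]
  rw [mul_assoc (z k ^ n), mul_div_mul_left _ _ (pow_ne_zero n h4)]
  generalize ∏ j ∈ univ.erase k, (α - (z k)⁻¹ - (α - (z j)⁻¹)) = D
  field_simp
  ring

/-- The polynomial whose values at `v_k²` form row `j` of `V`. -/
noncomputable def rowPoly (M : ℕ) (α : ℂ) (j : ℕ) : Polynomial ℂ :=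
  ∑ m ∈ range (j + 1), Polynomial.C ((-1) ^ m * α ^ (M - m) * (M.choose m : ℂ))
    * Polynomial.X ^ (j - m)

theorem rowPoly_natDegree_le (M : ℕ) (α : ℂ) (j : ℕ) : (rowPoly M α j).natDegree ≤ j :=
  Polynomial.natDegree_sum_le_of_forall_le _ _ fun _ _ =>
    (Polynomial.natDegree_C_mul_X_pow_le _ _).trans (Nat.sub_le _ _)

theorem rowPoly_coeff (M : ℕ) (α : ℂ) (j : ℕ) : (rowPoly M α j).coeff j = α ^ M := by
  rw [rowPoly, Polynomial.finsetSum_coeff, sum_range_succ', sum_eq_zero]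
  · rw [Polynomial.coeff_C_mul_X_pow]
    simp
  · intro m hm
    rw [Polynomial.coeff_C_mul_X_pow, if_neg]
    have := mem_range.1 hm
    omega

theorem rowPoly_eval (M : ℕ) (α : ℂ) (j : ℕ) (x : ℂ) :
    (rowPoly M α j).eval (x ^ 2) = ∑ m ∈ range (j + 1),
      (-1) ^ m * α ^ (M - m) * (M.choose m : ℂ) * x ^ (-2 * ((m : ℤ) - ((j : ℤ) + 1) + 1)) := by
  rw [rowPoly, Polynomial.eval_finsetSum]
  refine sum_congr rfl fun m hm => ?_
  have hm' := Nat.lt_succ_iff.1 (mem_range.1 hm)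
  rw [Polynomial.eval_mul, Polynomial.eval_C, Polynomial.eval_pow, Polynomial.eval_X, ← pow_mul,
    ← zpow_natCast x]
  congr 2
  push_cast [hm']
  ring

/-- The last row of `V` agrees with `z ^ (N - 1) * (α ^ M - t ^ M)` up to a polynomial of lower
degree. -/
theorem lastRow_sum_eq (M n : ℕ) (α x : ℂ) (hx : x ≠ 0) :
    -∑ m ∈ Icc (max n 1) M, (-1) ^ m * α ^ (M - m) * (M.choose m : ℂ)
        * x ^ (-2 * ((m : ℤ) - ((n : ℤ) + 1) + 1))
      = -((x ^ 2) ^ n * ((α - (x ^ 2)⁻¹) ^ M - α ^ M))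
        + (∑ m ∈ Ico 1 n, Polynomial.C ((-1) ^ m * α ^ (M - m) * (M.choose m : ℂ))
          * Polynomial.X ^ (n - m)).eval (x ^ 2) := by
  set c : ℕ → ℂ := fun m => (-1) ^ m * α ^ (M - m) * (M.choose m : ℂ) with hc
  set g : ℕ → ℂ := fun m => c m * x ^ (-2 * ((m : ℤ) - ((n : ℤ) + 1) + 1)) with hg
  have hx2 : x ^ 2 ≠ 0 := pow_ne_zero 2 hx
  have hgm : ∀ m, g m = (x ^ 2) ^ n * (c m * ((x ^ 2)⁻¹) ^ m) := by
    intro m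
    have : x ^ (-2 * ((m : ℤ) - ((n : ℤ) + 1) + 1)) = (x ^ 2) ^ n * ((x ^ 2)⁻¹) ^ m := by
      rw [← pow_mul, inv_pow, ← pow_mul, ← zpow_natCast x, ← zpow_natCast x, ← _root_.zpow_neg,
        ← zpow_add₀ hx]
      congr 1
      push_cast
      ring
    rw [hg]
    simp only [this]
    ring
  have hbin : (α - (x ^ 2)⁻¹) ^ M = ∑ m ∈ range (M + 1), c m * ((x ^ 2)⁻¹) ^ m := by
    rw [sub_eq_add_neg, add_comm, add_pow]
    refine sum_congr rfl fun m _ => ?_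
    rw [neg_pow, hc]
    ring
  -- Subtracting `α ^ M` removes the term `m = 0`; this is also why the sum in the last row starts
  -- at `max n 1` when `n = 0`.
  have htot : (x ^ 2) ^ n * ((α - (x ^ 2)⁻¹) ^ M - α ^ M) = ∑ m ∈ Ico 1 (M + 1), g m := by
    rw [hbin, sum_range_eq_add_Ico _ (Nat.succ_pos M)]
    simp [hgm, hc, mul_sum]
  have hpoly : (∑ m ∈ Ico 1 n, Polynomial.C (c m) * Polynomial.X ^ (n - m)).eval (x ^ 2)
      = ∑ m ∈ Ico 1 n, g m := by
    rw [Polynomial.eval_finsetSum]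
    refine sum_congr rfl fun m hm => ?_
    have hm' := (mem_Ico.1 hm).2.le
    rw [hgm, Polynomial.eval_mul, Polynomial.eval_C, Polynomial.eval_pow, Polynomial.eval_X,
      pow_sub₀ _ hx2 hm', inv_pow]
    ring
  have hzero : ∀ m, M < m → g m = 0 := fun m hm => by
    simp [hgm, hc, Nat.choose_eq_zero_of_lt hm]
  have hsplit : ∑ m ∈ Ico 1 (M + 1), g m
      = ∑ m ∈ Ico 1 n, g m + ∑ m ∈ Icc (max n 1) M, g m := by
    have hd : Disjoint (Ico 1 n) (Icc (max n 1) M) := by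
      rw [disjoint_left]
      intro m h1 h2
      rw [mem_Ico] at h1
      rw [mem_Icc] at h2
      omega
    rw [← sum_union hd]
    refine sum_subset ?_ ?_
    · intro m hm
      simp only [mem_Ico, mem_union, mem_Icc] at hm ⊢
      omega
    · intro m hm hm'
      simp only [mem_Ico, mem_union, mem_Icc] at hm hm'
      exact hzero m (by omega)
  change -∑ m ∈ Icc (max n 1) M, g m = _
  rw [htot, hpoly, hsplit]
  ring

theorem matV_det (M n : ℕ) (α : ℂ) (v : Fin (n + 1) → ℂ) (hv : ∀ j, v j ≠ 0)
    (hd : ∀ j k, j ≠ k → v j ^ 2 ≠ v k ^ 2) :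
    (matV M α v).det = (∏ j, ∏ k ∈ Ioi j, (v k ^ 2 - v j ^ 2))
      * (α ^ (M * n) * (∏ j, (v j ^ 2)⁻¹) * dividedDiff (spectralNodes α v) fun x => x ^ M) := by
  have hz : Function.Injective fun k => v k ^ 2 := fun j k h => by
    by_contra hjk
    exact hd j k hjk h
  have h0 : ∀ k, v k ^ 2 ≠ 0 := fun k => pow_ne_zero 2 (hv k)
  set R : Polynomial ℂ := ∑ m ∈ Ico 1 n, Polynomial.C ((-1) ^ m * α ^ (M - m) * (M.choose m : ℂ))
    * Polynomial.X ^ (n - m) with hR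
  set S := univ.image fun k => v k ^ 2 with hS
  have hcard : #S = n + 1 := by rw [hS, card_image_of_injective _ hz]; simp
  have hRd : dividedDiff S (fun x => R.eval x) = 0 := by
    have hdeg : R.degree < (n : ℕ) := by
      rw [Polynomial.degree_lt_iff_coeff_zero]
      intro i hi
      rw [hR, Polynomial.finsetSum_coeff]
      refine sum_eq_zero fun m hm => ?_
      rw [Polynomial.coeff_C_mul_X_pow, if_neg]
      have := mem_Ico.1 hm
      omega
    rw [dividedDiff_eval (hdeg.trans (by rw [hcard]; exact_mod_cast n.lt_succ_self)), hcard]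
    exact Polynomial.coeff_eq_zero_of_degree_lt hdeg
  have hnot : α ∉ univ.image fun k => α - (v k ^ 2)⁻¹ := by
    simp only [mem_image, mem_univ, true_and, not_exists]
    intro k hk
    exact inv_ne_zero (h0 k) (by linear_combination -hk)
  -- Subtracting the constant `α ^ M` changes nothing; the factor `x - α` of `x ^ M - α ^ M` then
  -- removes the node `α`.
  have hspec : dividedDiff (spectralNodes α v) (fun x => x ^ M)
      = dividedDiff (univ.image fun k => α - (v k ^ 2)⁻¹)
          fun x => ∑ i ∈ range M, x ^ i * α ^ (M - 1 - i) := by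
    have h2 : 2 ≤ #(spectralNodes α v) := by
      rw [spectralNodes, card_insert_of_notMem hnot]
      have : 0 < #(univ.image fun k => α - (v k ^ 2)⁻¹) :=
        card_pos.2 (univ_nonempty.image _)
      omega
    rw [← dividedDiff_insert_sub_mul hnot, ← add_zero (dividedDiff _ _)]
    conv_rhs => rw [← spectralNodes]
    rw [← dividedDiff_const h2 (-α ^ M), ← dividedDiff_add]
    congr 1
    funext x
    rw [mul_comm, geom_sum₂_mul]
    ring
  -- The last row is written with the factor `t - α = -1/z` explicit, as `dividedDiff_inv` needs it;
  -- the remainder `R` has degree below `n` and contributes nothing.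
  rw [det_of_eval_of_last hz (fun j : Fin n => rowPoly M α j) (fun j => rowPoly_natDegree_le M α j)
    (fun z => (-1) * (z ^ n * ((α - z⁻¹ - α) * ∑ i ∈ range M, (α - z⁻¹) ^ i * α ^ (M - 1 - i)))
      + R.eval z), dividedDiff_add, hRd, dividedDiff_mul,
    dividedDiff_inv hz h0 α (fun x => ∑ i ∈ range M, x ^ i * α ^ (M - 1 - i)), hspec]
  · simp only [rowPoly_coeff, prod_const, card_univ, Fintype.card_fin, ← pow_mul]
    ring
  · intro j k
    rw [rowPoly_eval, matV, of_apply, if_pos (by simp)]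
    simp
  · intro k
    rw [matV, of_apply, if_neg (by simp)]
    have := lastRow_sum_eq M n α (v k) (hv k)
    rw [mul_comm (_ - α), geom_sum₂_mul]
    simpa [hR] using this

/-! ### The two summation formulas. -/

theorem sum_configurations_wave_eq (M : ℕ) {N : ℕ} (α : ℂ) (v : Fin N → ℂ) (hv : ∀ j, v j ≠ 0)
    (hd : ∀ j k, j ≠ k → v j ^ 2 ≠ v k ^ 2) :
    ∑ x ∈ configurations M N, α ^ (M * N - posSum x) * wave α x v
      = (∏ j, v j ^ (M + 1)) * (∏ j, ∏ k ∈ Ioi j, 1 / (v k ^ 2 - v j ^ 2))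
        * (matV M α v).det := by
  rw [sum_configurations_wave, occWeight_dotProduct_stateKet M α v hv hd]
  cases N with
  | zero => simp
  | succ n =>
    have hne : ∏ j, ∏ k ∈ Ioi j, (v k ^ 2 - v j ^ 2) ≠ 0 :=
      prod_ne_zero_iff.2 fun j _ => prod_ne_zero_iff.2 fun k hk =>
        sub_ne_zero.2 (hd k j (mem_Ioi.1 hk).ne')
    rw [matV_det M n α v hv hd, if_neg (Nat.succ_ne_zero n), Nat.add_sub_cancel,
      prod_mul_distrib]
    simp only [one_div, prod_inv_distrib]
    field_simp

/-- Reversing both rows and columns preserves the determinant, so the dual formula reduces to the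
first one with the parameters in reverse order. -/
theorem matVtilde_eq (M : ℕ) {N : ℕ} (α : ℂ) (u : Fin N → ℂ) :
    matVtilde M α u
      = (matV M α fun j => u j.rev).submatrix (Fin.revPerm : Fin N ≃ Fin N) Fin.revPerm := by
  ext j k
  have hj := j.2
  simp only [matVtilde, matV, submatrix_apply, of_apply, Fin.revPerm_apply, Fin.rev_rev,
    Fin.val_rev]
  refine if_congr (by omega) (sum_congr rfl fun m _ => ?_) rfl
  congr 2
  push_cast [Nat.succ_le_of_lt hj]
  ring

theorem prod_Ioi_rev {N : ℕ} (f : Fin N → Fin N → ℂ) :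
    ∏ j : Fin N, ∏ k ∈ Ioi j, f k.rev j.rev = ∏ j : Fin N, ∏ k ∈ Ioi j, f j k := by
  rw [prod_sigma', prod_sigma']
  refine prod_nbij' (fun p => ⟨p.2.rev, p.1.rev⟩) (fun p => ⟨p.2.rev, p.1.rev⟩) ?_ ?_ ?_ ?_ ?_ <;>
    simp

end FiveVertex

theorem mainTheorem9 (M N : ℕ) (α : ℂ) :
    (∀ v : Fin N → ℂ, (∀ j, v j ≠ 0) → (∀ j k, j ≠ k → v j ^ 2 ≠ v k ^ 2) →
      ∑ x ∈ FiveVertex.configurations M N,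
          α ^ (M * N - FiveVertex.posSum x) * FiveVertex.wave α x v
        = (∏ j, v j ^ (M + 1)) * (∏ j, ∏ k ∈ Finset.Ioi j, 1 / (v k ^ 2 - v j ^ 2))
            * (FiveVertex.matV M α v).det) ∧
    (∀ u : Fin N → ℂ, (∀ j, u j ≠ 0) → (∀ j k, j ≠ k → u j ^ 2 ≠ u k ^ 2) →
      ∑ x ∈ FiveVertex.configurations M N,
          α ^ (FiveVertex.posSum x - N) * FiveVertex.dualWave α u x
        = (∏ j, u j ^ (M + 1)) * (∏ j, ∏ k ∈ Finset.Ioi j, 1 / (u j ^ 2 - u k ^ 2))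
            * (FiveVertex.matVtilde M α u).det) := by
  refine ⟨fun v hv hd => FiveVertex.sum_configurations_wave_eq M α v hv hd, fun u hu hd => ?_⟩
  rw [FiveVertex.sum_configurations_dualWave,
    FiveVertex.sum_configurations_wave_eq M α _ (fun j => hu j.rev)
      (fun j k hjk => hd _ _ (Fin.rev_injective.ne hjk)),
    FiveVertex.matVtilde_eq, Matrix.det_submatrix_equiv_self,
    FiveVertex.prod_Ioi_rev fun j k => 1 / (u j ^ 2 - u k ^ 2)]
  congr 2
  exact Equiv.prod_comp Fin.revPerm fun j => u j ^ (M + 1)
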